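/- Fix an alphabet: a signature $\Sigma$ of function symbols with arities, and predicate symbols with arities. A substitution $\theta\colon n\to m$ is an $n$-tuple of $\Sigma$-terms in the variables $x_1,\dots,x_m$; with the composition $\theta_2\circ\theta_1$ given by replacing variables in $\theta_1$ by the terms of $\theta_2$, substitutions are the arrows of a category $\mathbf{L}^{op}_\Sigma$ whose objects are the natural numbers. Let $At(n)$ be the set of atoms in the variables $x_1,\dots,x_n$, and for $A\in At(n)$, $\theta\colon n\to m$ let $A\theta\in At(m)$ be the substitution instance. A program $\mathbb P$ is a finite set of clauses $H\leftarrow B_1,\dots,B_j$ ($j\ge 0$) with $H,B_1,\dots,B_j\in At(c)$ for some $c$ (depending on the clause). A goal is a list $G=[A_1,\dots,A_k]$ ($k\ge 0$) of atoms in $At(n)$. For $A\in At(n)$ and $H\in At(c)$, a unifier of $A$ and $H$ is a pair $\langle\sigma,\tau\rangle$ of substitutions $\sigma\colon n\to m$, $\tau\colon c\to m$ with $A\sigma=H\tau$; it is most general if, moreover, $A=P(t)$, $H=P(t')$ and $\langle \sigma,\tau\rangle$ is a pushout of $t$ and $t'$ in $\mathbf{L}^{op}_\Sigma$. The saturated $\vee$-tree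 for $G$ in $\mathbb P$ is the rooted, possibly infinite tree whose nodes are labeled with lists of atoms and whose edges are labeled with substitutions, such that the root is labeled with $G$ and a node labeled with $[A'_1,\dots,A'_r]\in At(m)^r$ has exactly one child for each choice of clauses $C_1,\dots,C_r$ of $\mathbb P$ and substitutions $\sigma\colon m\to z$, $\tau_1,\dots,\tau_r$ such that $\langle\sigma,\tau_i\rangle$ is a unifier of $A'_i$ and the head of $C_i$ for every $i$ (and no other children); the edge to this child is labeled with $\sigma$, and the child is labeled with the concatenation of the lists obtained by applying $\tau_i$ to the body of $C_i$, $i=1,\dots,r$. A refutation subtree of this tree is a finite sequence of nodes $s_1,\dots,s_q$ ($q\ge 1$) such that $s_1$ is the root, $s_{i+1}$ is a child of $s_i$, and $s_q$ is labeled with the empty list; its answer is the composite $\theta_{q-1}\circ\dots\circ\theta_1$ of the labels $\theta_i$ of the edges from $s_i$ to $s_{i+1}$ (the identity if $q=1$). An SLD-refutation of $G$ in $\mathbb P$ is a finite sequence of steps that starts at $G$ and ends at the empty goal. In each step an atom $A$ of the current goal and a clause $C$ of $\mathbb P$ are selected, together with a most general unifier $\langle\sigma,\tau\rangle$ of $A$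 and the head of $C$; the selected occurrence of $A$ is replaced by the body of $C$ instantiated by $\tau$, and $\sigma$ is applied to the other atoms of the goal. Its computed answer is the composite of the substitutions $\sigma$ of its steps. A substitution $\theta$ is a correct answer of it if $\theta=\rho\circ\kappa$ for the computed answer $\kappa$ and some substitution $\rho$. **Theorem (Soundness and Completeness II).** Let $\mathbb P$ be a logic program, $G=[A_1,\dots,A_k]$ a goal with $A_1,\dots,A_k\in At(n)$, and $\theta\colon n\to m$ a substitution. The following are equivalent. 1. The saturated $\vee$-tree for $G$ in $\mathbb P$ has a refutation subtree with answer $\theta$. 2. There is an SLD-refutation for $G$ in $\mathbb P$ with correct answer $\theta$. -/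

import Mathlib

open CategoryTheory

namespace LP

/- An alphabet is a first-order language `L`: its function symbols with their arities form the
signature, its relation symbols are the predicate symbols. `Ctx L` is the type of objects of the
opposite Lawvere theory of the signature: the object of size `n` stands for the variables
`x_1, ..., x_n`. -/
structure Ctx (L : FirstOrder.Language) where
  size : ℕ

variable {L : FirstOrder.Language}

/-- Substitutions `n ⟶ m` are `n`-tuples of terms in the variables `x_1, ..., x_m`. The composite
`θ₂ ∘ θ₁` is written `θ₁ ≫ θ₂`. -/
instance : Category (Ctx L) where
  Hom n m := Fin n.size → L.Term (Fin m.size)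
  id n := fun i => FirstOrder.Language.Term.var i
  comp f g := fun i => (f i).subst g
  id_comp f := rfl
  comp_id {n m} f := by
    funext i
    induction f i with
    | var x => rfl
    | func F ts ih => exact congrArg (FirstOrder.Language.Term.func F) (funext ih)
  assoc {n m k l} f g h := by
    funext i
    change ((f i).subst g).subst h = (f i).subst (fun j => (g j).subst h)
    induction f i with
    | var x => rfl
    | func F ts ih => exact congrArg (FirstOrder.Language.Term.func F) (funext ih)

/-- `Atom n` is the set `At(n)` of atoms `P(t_1, ..., t_r)` in the variables `x_1, ..., x_n`. The
tuple of arguments is a morphism `r ⟶ n`. -/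
structure Atom (n : Ctx L) where
  arity : ℕ
  pred : L.Relations arity
  args : (⟨arity⟩ : Ctx L) ⟶ n

/-- The instance `Aθ` of an atom `A`. -/
def Atom.subst {n m : Ctx L} (A : Atom n) (θ : n ⟶ m) : Atom m :=
  ⟨A.arity, A.pred, A.args ≫ θ⟩

/-- A goal is a list of atoms. -/
abbrev Goal (n : Ctx L) : Type _ := List (Atom n)

/-- The instance `Gθ` of a list of atoms. -/
def Goal.subst {n m : Ctx L} (G : Goal n) (θ : n ⟶ m) : Goal m :=
  G.map (fun A => A.subst θ)

variable (L) in
/-- A clause `H ← B_1, ..., B_k` in the variables of the context `ctx`. -/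
structure Clause where
  ctx : Ctx L
  head : Atom ctx
  body : List (Atom ctx)

variable (L) in
/-- A logic program is a finite set of clauses. -/
abbrev Program : Type _ := Finset (Clause L)

/-- `⟨σ, τ⟩` is a unifier of the atoms `A` and `H`. -/
def IsUnifier {n c m : Ctx L} (A : Atom n) (H : Atom c) (σ : n ⟶ m) (τ : c ⟶ m) : Prop :=
  A.subst σ = H.subst τ

/-- `⟨σ, τ⟩` is a most general unifier of `A` and `H`: both atoms have the same predicate symbol
and `⟨σ, τ⟩` is a pushout of their tuples of arguments. As the clause side has its own context,
variables are automatically standardized apart. -/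
def IsMGU {n c m : Ctx L} (A : Atom n) (H : Atom c) (σ : n ⟶ m) (τ : c ⟶ m) : Prop :=
  ∃ (r : ℕ) (p : L.Relations r) (t : (⟨r⟩ : Ctx L) ⟶ n) (t' : (⟨r⟩ : Ctx L) ⟶ c),
    A = ⟨r, p, t⟩ ∧ H = ⟨r, p, t'⟩ ∧ IsPushout t t' σ τ

/-! ### SLD-resolution -/

/-- `SLDStep P G σ G'`: one step of SLD-resolution. An atom `A` of the current goal and a clause
`C` of the program are selected, with a most general unifier `⟨σ, τ⟩` of `A` and the head of `C`;
`A` is replaced by the body of `C`, and the unifier is applied. -/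
inductive SLDStep (P : Program L) {n m : Ctx L} : Goal n → (n ⟶ m) → Goal m → Prop
  | mk (l₁ : Goal n) (A : Atom n) (l₂ : Goal n) (C : Clause L) (hC : C ∈ P)
      (σ : n ⟶ m) (τ : C.ctx ⟶ m) (h : IsMGU A C.head σ τ) :
      SLDStep P (l₁ ++ A :: l₂) σ
        (Goal.subst l₁ σ ++ Goal.subst C.body τ ++ Goal.subst l₂ σ)

/-- `SLDRefutation P G ρ`: there is an SLD-refutation of `G` in `P` with computed answer `ρ`, the
composite of the goal components of the most general unifiers of its steps. -/
inductive SLDRefutation (P : Program L) : {n m : Ctx L} → Goal n → (n ⟶ m) → Prop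
  | nil (n : Ctx L) : SLDRefutation P ([] : Goal n) (𝟙 n)
  | step {n m k : Ctx L} {G : Goal n} {σ : n ⟶ m} {G' : Goal m} {ρ : m ⟶ k} :
      SLDStep P G σ G' → SLDRefutation P G' ρ → SLDRefutation P G (σ ≫ ρ)

/-- `G` has an SLD-refutation in `P` with correct answer `θ`: the substitution `θ` factors through
the computed answer. -/
def HasSLDRefutationWithCorrectAnswer (P : Program L) {n m : Ctx L} (G : Goal n)
    (θ : n ⟶ m) : Prop :=
  ∃ (k : Ctx L) (ρ : n ⟶ k) (σ : k ⟶ m), SLDRefutation P G ρ ∧ ρ ≫ σ = θ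

/-! ### Trees and refutation subtrees -/

variable (L) in
/-- Possibly infinite rooted trees whose nodes are labeled with goals (in varying contexts) and
whose edges are labeled with substitutions; `Edge s t σ` says that `t` is a child of `s` and that
the edge from `s` to `t` is labeled with `σ`. -/
structure OrTree where
  Node : Type*
  ctx : Node → Ctx L
  label : (s : Node) → Goal (ctx s)
  root : Node
  Edge : (s t : Node) → (ctx s ⟶ ctx t) → Prop
  not_edge_root : ∀ s σ, ¬ Edge s root σ
  edge_unique : ∀ s s' t σ σ', Edge s t σ → Edge s' t σ' → s = s' ∧ HEq σ σ'
  reachable : ∀ s, Relation.ReflTransGen (fun a b => ∃ σ, Edge a b σ) root s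

/-- Finite sequences of nodes from `s` to `t` in which each node is a child of the preceding one. -/
inductive OrTree.Path (T : OrTree L) : T.Node → T.Node → Type _
  | nil (s : T.Node) : T.Path s s
  | cons {s t u : T.Node} (σ : T.ctx s ⟶ T.ctx t) (h : T.Edge s t σ) (p : T.Path t u) : T.Path s u

/-- The composite of the substitutions that label the edges of a path. -/
def OrTree.Path.answer {T : OrTree L} : {s t : T.Node} → T.Path s t → (T.ctx s ⟶ T.ctx t)
  | _, _, .nil s => 𝟙 (T.ctx s)
  | _, _, .cons σ _ p => σ ≫ p.answer

/-- `T` has a refutation subtree with answer `θ`: a finite path from the root to a node labeled with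
the empty list along which the substitutions compose to `θ` (targets included). -/
def OrTree.HasRefutationSubtree (T : OrTree L) {m : Ctx L} (θ : T.ctx T.root ⟶ m) : Prop :=
  ∃ (t : T.Node) (p : T.Path T.root t), T.label t = [] ∧
    (⟨T.ctx t, p.answer⟩ : Σ k : Ctx L, T.ctx T.root ⟶ k) = ⟨m, θ⟩

/-! ### The saturated ∨-tree -/

/-- The index of a child of a node labeled with `l = [A_1, ..., A_k]`: clauses `C_1, ..., C_k` of
the program and substitutions `σ, τ_1, ..., τ_k` such that `⟨σ, τ_i⟩` is a unifier of `A_i` and the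
head of `C_i` for each `i`. -/
structure Branch (P : Program L) {m : Ctx L} (l : Goal m) where
  target : Ctx L
  σ : m ⟶ target
  clause : Fin l.length → Clause L
  clause_mem : ∀ i, clause i ∈ P
  τ : ∀ i, (clause i).ctx ⟶ target
  unifier : ∀ i, IsUnifier (l.get i) (clause i).head σ (τ i)

/-- The label of the child: the concatenation of the instances `body (C_i) τ_i`. -/
def Branch.goal {P : Program L} {m : Ctx L} {l : Goal m} (b : Branch P l) : Goal b.target :=
  (List.ofFn (fun i => Goal.subst (b.clause i).body (b.τ i))).flatten

/-- Nodes of the saturated ∨-tree of `G`, indexed by their label: the root is labeled with `G`, and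
a node labeled with `l` has exactly one child for every `b : Branch P l`. -/
inductive SatNode (P : Program L) {n : Ctx L} (G : Goal n) : (m : Ctx L) → Goal m → Type _
  | root : SatNode P G n G
  | child {m : Ctx L} {l : Goal m} (s : SatNode P G m l) (b : Branch P l) :
      SatNode P G b.target b.goal

/-- A node of the saturated ∨-tree together with its label. -/
structure SatNodes (P : Program L) {n : Ctx L} (G : Goal n) where
  ctx : Ctx L
  label : Goal ctx
  node : SatNode P G ctx label

/-- The child of `s` with index `b`. -/
def SatNodes.child {P : Program L} {n : Ctx L} {G : Goal n} (s : SatNodes P G)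
    (b : Branch P s.label) : SatNodes P G :=
  ⟨b.target, b.goal, s.node.child b⟩

/-- The edge from `s` to its child with index `b` is labeled with the substitution `b.σ`. -/
inductive SatEdge (P : Program L) {n : Ctx L} (G : Goal n) :
    (s t : SatNodes P G) → (s.ctx ⟶ t.ctx) → Prop
  | mk (s : SatNodes P G) (b : Branch P s.label) : SatEdge P G s (s.child b) b.σ

/-- The parent of a node, with the index of the node among the children of its parent. -/
def SatNodes.parent {P : Program L} {n : Ctx L} {G : Goal n} :
    SatNodes P G → Option (Σ s : SatNodes P G, Branch P s.label)
  | ⟨_, _, .root⟩ => none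
  | ⟨_, _, .child s b⟩ => some ⟨⟨_, _, s⟩, b⟩

theorem SatEdge.exists_parent {P : Program L} {n : Ctx L} {G : Goal n} {s t : SatNodes P G}
    {σ : s.ctx ⟶ t.ctx} (h : SatEdge P G s t σ) :
    ∃ b : Branch P s.label, t.parent = some ⟨s, b⟩ ∧ HEq σ b.σ := by
  cases h with
  | mk b => exact ⟨b, rfl, HEq.rfl⟩

/-- The saturated ∨-tree for the goal `G` in the program `P`. -/
def saturatedOrTree (P : Program L) {n : Ctx L} (G : Goal n) : OrTree L where
  Node := SatNodes P G
  ctx s := s.ctx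
  label s := s.label
  root := ⟨n, G, .root⟩
  Edge := SatEdge P G
  not_edge_root := by
    intro s σ h
    obtain ⟨b, hb, -⟩ := h.exists_parent
    exact Option.noConfusion rfl (heq_of_eq hb)
  edge_unique := by
    intro s s' t σ σ' h h'
    obtain ⟨b, hb, e⟩ := h.exists_parent
    obtain ⟨b', hb', e'⟩ := h'.exists_parent
    have := Option.some.inj (hb.symm.trans hb')
    cases this
    exact ⟨rfl, e.trans e'.symm⟩
  reachable := by
    rintro ⟨m, l, s⟩
    induction s with
    | root => exact .refl
    | child s b ih => exact ih.tail ⟨b.σ, SatEdge.mk ⟨_, _, s⟩ b⟩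

end LP

/-!
Both conditions say that every atom `Aθ`, for `A` in `G`, has a proof tree built from instances of
clauses of the program over the single context `m` (`LP.Derivable`, a bound on the height included).

* In the saturated ∨-tree a node may be resolved with *arbitrary* unifiers. Hence the whole answer
  `θ` can be used on the first edge and identities on all later ones, each level of the tree
  resolving simultaneously one level of all proof trees (`LP.exists_path_of_derivable`). Conversely,
  derivability is stable under substitution, so it can be read off a path from its end backwards
  (`LP.derivable_of_path`).
* An SLD-refutation is sound for the same reason (`LP.SLDRefutation.derivable`). For completeness,
  the proof trees are first flattened to a leftmost refutation that uses instances of clauses only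
  (`LP.InstRefutation`). It is then lifted step by step (`LP.InstRefutation.lift`): the unifier
  `⟨θ, τ⟩` of a step factors uniquely through a most general one, and the factor takes over the
  role of `θ` for the rest of the refutation.

The lifting needs the unification theorem in its categorical form: a span of substitutions that can
be completed to a commutative square has a pushout (`LP.exists_isPushout`). Since a context has
binary coproducts, this amounts to coequalizers of unifiable families of equations. They are found
by structural induction on the common instance `w` of the two terms under *some* unifier
(`LP.hasMGU_of_subst_eq`). If one of the terms is a variable, it is eliminated; otherwise the
equation decomposes into equations between arguments, which are solved one after the other. The
given unifier factors through each partial solution, so the common instances of the remaining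
arguments do not change, and no measure on the number of variables is needed.
-/

namespace LP

open FirstOrder.Language

variable {L : FirstOrder.Language}

/-! ### Most general unifiers of sets of equations -/

theorem comp_apply {n m k : Ctx L} (f : n ⟶ m) (g : m ⟶ k) (i : Fin n.size) :
    (f ≫ g) i = (f i).subst g := rfl

theorem subst_comp {n m k : Ctx L} (t : L.Term (Fin n.size)) (f : n ⟶ m) (g : m ⟶ k) :
    t.subst (f ≫ g) = (t.subst f).subst g :=
  (congrFun (Category.assoc (fun _ : Fin 1 => t : (⟨1⟩ : Ctx L) ⟶ n) f g) 0).symm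

theorem subst_id {n : Ctx L} (t : L.Term (Fin n.size)) : t.subst (𝟙 n : n ⟶ n) = t := by
  let f : (⟨1⟩ : Ctx L) ⟶ n := fun _ => t
  exact congrFun (Category.comp_id f) (0 : Fin 1)

/-- The substitution `f` solves all equations in `E`. -/
def Unifies {n m : Ctx L} (E : Set (L.Term (Fin n.size) × L.Term (Fin n.size))) (f : n ⟶ m) :
    Prop :=
  ∀ e ∈ E, e.1.subst f = e.2.subst f

/-- `E` has a most general unifier, in the strong sense that every unifier factors *uniquely*
through it: a coequalizer of the two families of terms in the category of contexts. -/
def HasMGU {n : Ctx L} (E : Set (L.Term (Fin n.size) × L.Term (Fin n.size))) : Prop :=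
  ∃ (k : Ctx L) (q : n ⟶ k), Unifies E q ∧
    ∀ (l : Ctx L) (f : n ⟶ l), Unifies E f → ∃! u : k ⟶ l, q ≫ u = f

theorem hasMGU_of_forall_eq {n : Ctx L} {E : Set (L.Term (Fin n.size) × L.Term (Fin n.size))}
    (h : ∀ e ∈ E, e.1 = e.2) : HasMGU E :=
  ⟨n, 𝟙 n, fun e he => by rw [h e he], fun l f _ =>
    ⟨f, Category.id_comp f, fun u hu => (Category.id_comp u).symm.trans hu⟩⟩

/-- The number of symbols of a term. -/
def termSize {α : Type*} : L.Term α → ℕ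
  | .var _ => 1
  | .func _ ts => 1 + ∑ i, termSize (ts i)

/-- The occurs check: a term either does not contain `x`, or is `x`, or contains `x` properly, in
which case its instances are larger than those of `x`. -/
theorem occurs_trichotomy {N : ℕ} (x : Fin (N + 1)) (t : L.Term (Fin (N + 1))) :
    (∃ t' : L.Term (Fin N), t = t'.subst (fun j => Term.var (x.succAbove j))) ∨ t = Term.var x ∨
      ∀ (m : ℕ) (f : Fin (N + 1) → L.Term (Fin m)), termSize (f x) < termSize (t.subst f) := by
  induction t with
  | var y =>
    rcases Fin.eq_self_or_eq_succAbove x y with rfl | ⟨j, rfl⟩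
    · exact .inr (.inl rfl)
    · exact .inl ⟨Term.var j, rfl⟩
  | func F ts ih =>
    by_cases h : ∀ i, ∃ t' : L.Term (Fin N), ts i = t'.subst (fun j => Term.var (x.succAbove j))
    · choose t' ht' using h
      exact .inl ⟨Term.func F t', congrArg (Term.func F) (funext ht')⟩
    · push Not at h
      obtain ⟨i, hi⟩ := h
      refine .inr (.inr fun m f => ?_)
      have hle : termSize (f x) ≤ termSize ((ts i).subst f) := by
        rcases ih i with ⟨t', ht'⟩ | hx | hlt
        · exact absurd ht' (hi t')
        · rw [hx]; rfl
        · exact (hlt m f).le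
      have hsum : termSize ((ts i).subst f) ≤ ∑ j, termSize ((ts j).subst f) :=
        Finset.single_le_sum (f := fun j => termSize ((ts j).subst f))
          (fun _ _ => Nat.zero_le _) (Finset.mem_univ i)
      change _ < 1 + ∑ j, termSize ((ts j).subst f)
      omega

/-- Variable elimination: if `x` does not occur in `t`, substituting `t` for `x` removes `x` from the
context. Uniqueness of factors holds because this substitution has the inclusion of the remaining
variables as a section. -/
theorem hasMGU_var {n m : Ctx L} (x : Fin n.size) (t : L.Term (Fin n.size)) (f : n ⟶ m)
    (h : f x = t.subst f) : HasMGU {((Term.var x : L.Term (Fin n.size)), t)} := by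
  obtain ⟨N⟩ := n
  cases N with
  | zero => exact x.elim0
  | succ N =>
    rcases occurs_trichotomy x t with ⟨t', rfl⟩ | rfl | hlt
    · let ι : (⟨N⟩ : Ctx L) ⟶ ⟨N + 1⟩ := fun j => Term.var (x.succAbove j)
      let q : (⟨N + 1⟩ : Ctx L) ⟶ ⟨N⟩ := x.insertNth t' (fun j => Term.var j)
      have hqx : q x = t' := Fin.insertNth_apply_same (α := fun _ => L.Term (Fin N)) _ _ _
      have hqs (j) : q (x.succAbove j) = Term.var j :=
        Fin.insertNth_apply_succAbove (α := fun _ => L.Term (Fin N)) _ _ _ _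
      have hιq : ι ≫ q = 𝟙 _ := funext hqs
      refine ⟨⟨N⟩, q, ?_, fun l g hg => ⟨ι ≫ g, ?_, fun u hu => ?_⟩⟩
      · rintro _ rfl
        change q x = (t'.subst ι).subst q
        rw [← subst_comp, hιq, subst_id, hqx]
      · funext y
        rcases Fin.eq_self_or_eq_succAbove x y with rfl | ⟨j, rfl⟩
        · rw [comp_apply, hqx, subst_comp]
          exact (hg _ rfl).symm
        · rw [comp_apply, hqs]; rfl
      · change q ≫ u = g at hu
        rw [← hu, ← Category.assoc, hιq, Category.id_comp]
    · exact hasMGU_of_forall_eq (by rintro _ rfl; rfl)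
    · exact absurd (congrArg termSize h) (hlt _ f).ne

theorem HasMGU.swap {n : Ctx L} {s t : L.Term (Fin n.size)} (h : HasMGU {(s, t)}) :
    HasMGU {(t, s)} := by
  obtain ⟨k, q, hq, hu⟩ := h
  refine ⟨k, q, ?_, fun l f hf => hu l f ?_⟩
  · rintro _ rfl; exact (hq _ rfl).symm
  · rintro _ rfl; exact (hf _ rfl).symm

/-- A finite family of equations with a unifier `f` has a most general unifier, provided that single
equations do whenever their common instance is one of the common instances of the family. -/
theorem hasMGU_range {r : ℕ} {n m : Ctx L} (s t : Fin r → L.Term (Fin n.size)) (f : n ⟶ m)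
    (h : ∀ i, (s i).subst f = (t i).subst f)
    (ih : ∀ (i : Fin r) (k : Ctx L) (a b : L.Term (Fin k.size)) (g : k ⟶ m),
      a.subst g = (s i).subst f → b.subst g = (s i).subst f → HasMGU {(a, b)}) :
    HasMGU (Set.range fun i => (s i, t i)) := by
  suffices H : ∀ S : Finset (Fin r), HasMGU ((fun i => (s i, t i)) '' (S : Set (Fin r))) by
    simpa using H Finset.univ
  intro S
  induction S using Finset.induction_on with
  | empty => exact hasMGU_of_forall_eq (by simp)
  | insert i S _ ihS =>
    obtain ⟨k, q, hq, hu⟩ := ihS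
    obtain ⟨g, hg, -⟩ := hu m f (by rintro _ ⟨j, -, rfl⟩; exact h j)
    -- `f` factors as `q ≫ g`, so `g` unifies the `i`-th equation after `q`, with the same instance.
    obtain ⟨k', q', hq', hu'⟩ := ih i k ((s i).subst q) ((t i).subst q) g
      (by rw [← subst_comp, hg]) (by rw [← subst_comp, hg, h i])
    refine ⟨k', q ≫ q', ?_, fun l f' hf' => ?_⟩
    · rintro _ ⟨j, hj, rfl⟩
      rcases Finset.mem_insert.1 hj with rfl | hj
      · simpa only [subst_comp] using hq' _ rfl
      · simpa only [subst_comp] using congrArg (fun w => w.subst q') (hq _ ⟨j, hj, rfl⟩)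
    · obtain ⟨v, hv, hv'⟩ := hu l f' (by
        rintro _ ⟨j, hj, rfl⟩
        exact hf' _ ⟨j, Finset.mem_insert_of_mem hj, rfl⟩)
      obtain ⟨w, hw, hw'⟩ := hu' l v (by
        rintro _ rfl
        have := hf' _ ⟨i, Finset.mem_insert_self i S, rfl⟩
        rwa [← hv, subst_comp, subst_comp] at this)
      refine ⟨w, ?_, fun w₁ hw₁ => hw' _ (hv' _ ?_)⟩
      · change (q ≫ q') ≫ w = f'
        rw [Category.assoc, hw, hv]
      · exact (Category.assoc q q' w₁).symm.trans hw₁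

/-- The unification theorem for a single equation, by induction on the common instance `w`. -/
theorem hasMGU_of_subst_eq {m : Ctx L} (w : L.Term (Fin m.size)) :
    ∀ (n : Ctx L) (s t : L.Term (Fin n.size)) (f : n ⟶ m),
      s.subst f = w → t.subst f = w → HasMGU {(s, t)} := by
  induction w with
  | var y =>
    intro n s t f hs ht
    cases s with
    | var x => exact hasMGU_var x t f (hs.trans ht.symm)
    | func F ss => nomatch hs
  | func F ws ih =>
    intro n s t f hs ht
    cases s with
    | var x => exact hasMGU_var x t f (hs.trans ht.symm)
    | func F₁ ss =>
      cases t with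
      | var x => exact (hasMGU_var x _ f (ht.trans hs.symm)).swap
      | func F₂ ts =>
        simp only [Term.subst] at hs ht
        cases hs
        simp only [Term.func.injEq] at ht
        obtain ⟨rfl, hF, hts⟩ := ht
        cases hF
        have hts := congrFun (eq_of_heq hts)
        obtain ⟨k, q, hq, hu⟩ := hasMGU_range ss ts f (fun i => (hts i).symm)
          (fun i k a b g => ih i k a b g)
        refine ⟨k, q, ?_, fun l f' hf' => hu l f' ?_⟩
        · rintro _ rfl
          exact congrArg (Term.func F₂) (funext fun i => hq _ ⟨i, rfl⟩)
        · rintro _ ⟨i, rfl⟩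
          have := hf' _ rfl
          simp only [Term.subst, Term.func.injEq, heq_eq_eq, true_and] at this
          exact congrFun this i

/-- The unification theorem: a span of substitutions has a pushout as soon as it can be completed
to a commutative square. -/
theorem exists_isPushout {r n c m : Ctx L} (t : r ⟶ n) (t' : r ⟶ c) (θ : n ⟶ m) (τ : c ⟶ m)
    (h : t ≫ θ = t' ≫ τ) :
    ∃ (k : Ctx L) (σ : n ⟶ k) (σ' : c ⟶ k), IsPushout t t' σ σ' := by
  -- The context of size `n + c` is the coproduct of `n` and `c`.
  let s : Ctx L := ⟨n.size + c.size⟩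
  let inl : n ⟶ s := fun i => Term.var (Fin.castAdd c.size i)
  let inr : c ⟶ s := fun i => Term.var (Fin.natAdd n.size i)
  let desc {l : Ctx L} (f : n ⟶ l) (g : c ⟶ l) : s ⟶ l := Fin.append f g
  have inl_desc {l : Ctx L} (f : n ⟶ l) (g : c ⟶ l) : inl ≫ desc f g = f :=
    funext fun i => Fin.append_left f g i
  have inr_desc {l : Ctx L} (f : n ⟶ l) (g : c ⟶ l) : inr ≫ desc f g = g :=
    funext fun i => Fin.append_right f g i
  have hom_ext {l : Ctx L} {f g : s ⟶ l} (h₁ : inl ≫ f = inl ≫ g) (h₂ : inr ≫ f = inr ≫ g) :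
      f = g :=
    funext fun i => Fin.addCases (fun i => congrFun h₁ i) (fun i => congrFun h₂ i) i
  have unif {l : Ctx L} (f : s ⟶ l) :
      Unifies (Set.range fun i => ((t ≫ inl) i, (t' ≫ inr) i)) f ↔
        t ≫ inl ≫ f = t' ≫ inr ≫ f := by
    rw [← Category.assoc, ← Category.assoc]
    exact ⟨fun hf => funext fun i => hf _ ⟨i, rfl⟩, by rintro hf _ ⟨i, rfl⟩; exact congrFun hf i⟩
  obtain ⟨k, q, hq, hu⟩ := hasMGU_range (t ≫ inl) (t' ≫ inr) (desc θ τ)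
    (fun i => (unif (desc θ τ)).2 (by rw [inl_desc, inr_desc, h]) _ ⟨i, rfl⟩)
    (fun i k a b g => hasMGU_of_subst_eq _ k a b g)
  have hw (w : Limits.PushoutCocone t t') :=
    hu _ (desc w.inl w.inr) ((unif _).2 (by rw [inl_desc, inr_desc, w.condition]))
  refine ⟨k, inl ≫ q, inr ≫ q, ⟨⟨(unif q).1 hq⟩, ⟨Limits.PushoutCocone.IsColimit.mk _
    (fun w => (hw w).choose) (fun w => ?_) (fun w => ?_) (fun w v h₁ h₂ => ?_)⟩⟩⟩
  · rw [Category.assoc, (hw w).choose_spec.1, inl_desc]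
  · rw [Category.assoc, (hw w).choose_spec.1, inr_desc]
  · refine (hw w).choose_spec.2 v (hom_ext ?_ ?_)
    · rw [inl_desc, ← h₁, Category.assoc]
    · rw [inr_desc, ← h₂, Category.assoc]

theorem Atom.subst_subst {n m k : Ctx L} (A : Atom n) (f : n ⟶ m) (g : m ⟶ k) :
    (A.subst f).subst g = A.subst (f ≫ g) := by
  simp only [Atom.subst, Category.assoc]

theorem Atom.subst_id {n : Ctx L} (A : Atom n) : A.subst (𝟙 n) = A := by
  simp only [Atom.subst, Category.comp_id]

theorem Goal.subst_subst {n m k : Ctx L} (G : Goal n) (f : n ⟶ m) (g : m ⟶ k) :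
    Goal.subst (Goal.subst G f) g = Goal.subst G (f ≫ g) := by
  simp only [Goal.subst, List.map_map]
  exact List.map_congr_left fun A _ => A.subst_subst f g

theorem IsMGU.isUnifier {n c m : Ctx L} {A : Atom n} {H : Atom c} {σ : n ⟶ m} {τ : c ⟶ m}
    (h : IsMGU A H σ τ) : IsUnifier A H σ τ := by
  obtain ⟨r, p, t, t', rfl, rfl, hp⟩ := h
  simp only [IsUnifier, Atom.subst, hp.w]

/-- A unifier of two atoms factors through a most general one. -/
theorem IsUnifier.exists_isMGU {n c m : Ctx L} {A : Atom n} {H : Atom c} {θ : n ⟶ m} {τ : c ⟶ m}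
    (h : IsUnifier A H θ τ) :
    ∃ (k : Ctx L) (σ : n ⟶ k) (σ' : c ⟶ k) (u : k ⟶ m),
      IsMGU A H σ σ' ∧ σ ≫ u = θ ∧ σ' ≫ u = τ := by
  obtain ⟨r, p, t⟩ := A
  obtain ⟨r', p', t'⟩ := H
  simp only [IsUnifier, Atom.subst, Atom.mk.injEq] at h
  obtain ⟨rfl, hp, ht⟩ := h
  cases hp
  have ht := eq_of_heq ht
  obtain ⟨k, σ, σ', hpo⟩ := exists_isPushout t t' θ τ ht
  exact ⟨k, σ, σ', hpo.desc θ τ ht, ⟨r, p, t, t', rfl, rfl, hpo⟩, hpo.inl_desc _ _ _,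
    hpo.inr_desc _ _ _⟩

/-! ### Proof trees of bounded height -/

/-- `Derivable P d A`: the atom `A` has a proof tree of height at most `d` whose nodes are instances
of clauses of `P` in the context of `A`. -/
def Derivable (P : Program L) {m : Ctx L} : ℕ → Atom m → Prop
  | 0, _ => False
  | d + 1, A => ∃ C ∈ P, ∃ τ : C.ctx ⟶ m,
      A = C.head.subst τ ∧ ∀ B ∈ C.body, Derivable P d (B.subst τ)

theorem Derivable.succ {P : Program L} {m : Ctx L} {d : ℕ} {A : Atom m} (h : Derivable P d A) :
    Derivable P (d + 1) A := by
  induction d generalizing A with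
  | zero => exact h.elim
  | succ d ih =>
    obtain ⟨C, hC, τ, rfl, hB⟩ := h
    exact ⟨C, hC, τ, rfl, fun B hB' => ih (hB B hB')⟩

/-! ### The saturated ∨-tree and proof trees -/

theorem Branch.mem_goal {P : Program L} {m : Ctx L} {l : Goal m} {b : Branch P l}
    {A : Atom b.target} : A ∈ b.goal ↔ ∃ i, ∃ B ∈ (b.clause i).body, B.subst (b.τ i) = A := by
  simp only [Branch.goal, Goal.subst, List.mem_flatten, List.mem_ofFn]
  constructor
  · rintro ⟨_, ⟨i, rfl⟩, h⟩
    exact ⟨i, List.mem_map.1 h⟩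
  · rintro ⟨i, h⟩
    exact ⟨_, ⟨i, rfl⟩, List.mem_map.2 h⟩

theorem SatEdge.derivable {P : Program L} {n : Ctx L} {G : Goal n} {s t : SatNodes P G}
    {σ : s.ctx ⟶ t.ctx} (h : SatEdge P G s t σ) {m : Ctx L} {ρ : t.ctx ⟶ m} {d : ℕ}
    (ht : ∀ A ∈ t.label, Derivable P d (A.subst ρ)) :
    ∀ A ∈ s.label, Derivable P (d + 1) (A.subst (σ ≫ ρ)) := by
  cases h with
  | mk b =>
    change b.target ⟶ m at ρ
    intro A hA
    change Derivable P (d + 1) (A.subst (b.σ ≫ ρ))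
    obtain ⟨i, rfl⟩ := List.get_of_mem hA
    refine ⟨b.clause i, b.clause_mem i, b.τ i ≫ ρ, ?_, fun B hB => ?_⟩
    · rw [← Atom.subst_subst, b.unifier i, Atom.subst_subst]
    · rw [← Atom.subst_subst]
      exact ht _ (Branch.mem_goal.2 ⟨i, B, hB, rfl⟩)

/-- Stated for an arbitrary tree whose edges add one level to proof trees, so that the contexts and
labels of nodes are opaque in the induction. -/
theorem derivable_of_path {P : Program L} {T : OrTree L}
    (hT : ∀ {s t : T.Node} {σ : T.ctx s ⟶ T.ctx t}, T.Edge s t σ →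
      ∀ {m : Ctx L} {ρ : T.ctx t ⟶ m} {d : ℕ}, (∀ A ∈ T.label t, Derivable P d (A.subst ρ)) →
        ∀ A ∈ T.label s, Derivable P (d + 1) (A.subst (σ ≫ ρ)))
    {s t : T.Node} (p : T.Path s t) (ht : T.label t = []) :
    ∃ d, ∀ A ∈ T.label s, Derivable P d (A.subst p.answer) := by
  induction p with
  | nil s => exact ⟨0, fun A hA => by rw [ht] at hA; cases hA⟩
  | cons σ h p ih =>
    obtain ⟨d, hd⟩ := ih ht
    exact ⟨d + 1, hT h hd⟩

/-- The roots of proof trees of the atoms `Aθ` assemble to a branch with edge label `θ`, whose goal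
consists of the conclusions of the immediate subtrees. -/
theorem exists_branch {P : Program L} {n m : Ctx L} {l : Goal n} {θ : n ⟶ m} {d : ℕ}
    (h : ∀ A ∈ l, Derivable P (d + 1) (A.subst θ)) :
    ∃ (C : Fin l.length → Clause L) (hC : ∀ i, C i ∈ P) (τ : ∀ i, (C i).ctx ⟶ m)
      (hτ : ∀ i, IsUnifier (l.get i) (C i).head θ (τ i)),
      ∀ A ∈ (⟨m, θ, C, hC, τ, hτ⟩ : Branch P l).goal, Derivable P d A := by
  choose C hC τ hτ hB using fun i => h _ (l.get_mem i)
  refine ⟨C, hC, τ, hτ, fun A hA => ?_⟩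
  obtain ⟨i, B, hB', rfl⟩ := Branch.mem_goal.1 hA
  exact hB i B hB'

/-- The node is resolved along `θ` at once; all later edges are labeled with identities. -/
theorem exists_path_of_derivable {P : Program L} {n : Ctx L} {G : Goal n} (d : ℕ)
    (s : SatNodes P G) {m : Ctx L} (θ : s.ctx ⟶ m)
    (h : ∀ A ∈ s.label, Derivable P d (A.subst θ)) :
    ∃ (t : SatNodes P G) (p : (saturatedOrTree P G).Path s t), t.label = [] ∧
      (⟨t.ctx, p.answer⟩ : Σ k : Ctx L, s.ctx ⟶ k) = ⟨m, θ⟩ := by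
  induction d generalizing s m with
  | zero =>
    -- The goal is empty, and an empty goal has a child along every substitution.
    obtain ⟨C, hC, τ, hτ, hb⟩ := exists_branch (d := 0) (fun A hA => (h A hA).succ)
    let b : Branch P s.label := ⟨m, θ, C, hC, τ, hτ⟩
    refine ⟨s.child b, OrTree.Path.cons (T := saturatedOrTree P G) (s := s) (t := s.child b) b.σ
      (SatEdge.mk s b) (.nil _), List.eq_nil_iff_forall_not_mem.2 hb, ?_⟩
    exact congrArg (Sigma.mk m) (Category.comp_id θ)
  | succ d ih =>
    obtain ⟨C, hC, τ, hτ, hb⟩ := exists_branch h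
    let b : Branch P s.label := ⟨m, θ, C, hC, τ, hτ⟩
    obtain ⟨t, p, ht, hp⟩ := ih (s.child b) (𝟙 m) (fun A hA =>
      (congrArg (Derivable P d) (Atom.subst_id (n := m) A)).mpr (hb A hA))
    refine ⟨t, OrTree.Path.cons (T := saturatedOrTree P G) (s := s) (t := s.child b) b.σ
      (SatEdge.mk s b) p, ht, ?_⟩
    have := congrArg (fun x : Σ k : Ctx L, m ⟶ k => (⟨x.1, θ ≫ x.2⟩ : Σ k : Ctx L, s.ctx ⟶ k)) hp
    exact this.trans (congrArg (Sigma.mk m) (Category.comp_id θ))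

theorem hasRefutationSubtree_iff {P : Program L} {n m : Ctx L} {G : Goal n} {θ : n ⟶ m} :
    (saturatedOrTree P G).HasRefutationSubtree θ ↔
      ∃ d, ∀ A ∈ G, Derivable P d (A.subst θ) := by
  constructor
  · rintro ⟨t, p, ht, hp⟩
    obtain ⟨d, hd⟩ := derivable_of_path (fun h => SatEdge.derivable h) p ht
    let Q (x : Σ k : Ctx L, n ⟶ k) : Prop := ∀ A ∈ G, Derivable P d (A.subst x.2)
    exact ⟨d, (congrArg Q hp).mp hd⟩
  · rintro ⟨d, hd⟩
    exact exists_path_of_derivable d ⟨n, G, .root⟩ θ hd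

/-! ### SLD-refutations and proof trees -/

theorem SLDStep.derivable {P : Program L} {n m k : Ctx L} {G : Goal n} {σ : n ⟶ m} {G' : Goal m}
    (h : SLDStep P G σ G') {ρ : m ⟶ k} {d : ℕ} (hd : ∀ A ∈ G', Derivable P d (A.subst ρ)) :
    ∀ A ∈ G, Derivable P (d + 1) (A.subst (σ ≫ ρ)) := by
  obtain ⟨l₁, A, l₂, C, hC, σ, τ, hA⟩ := h
  simp only [Goal.subst, List.mem_append, List.mem_map] at hd
  intro B hB
  rcases List.mem_append.1 hB with hB | hB
  · rw [← Atom.subst_subst]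
    exact (hd _ (.inl (.inl ⟨B, hB, rfl⟩))).succ
  rcases List.mem_cons.1 hB with rfl | hB
  · refine ⟨C, hC, τ ≫ ρ, ?_, fun B hB => ?_⟩
    · rw [← Atom.subst_subst, hA.isUnifier, Atom.subst_subst]
    · rw [← Atom.subst_subst]
      exact hd _ (.inl (.inr ⟨B, hB, rfl⟩))
  · rw [← Atom.subst_subst]
    exact (hd _ (.inr ⟨B, hB, rfl⟩)).succ

theorem SLDRefutation.derivable {P : Program L} {n k m : Ctx L} {G : Goal n} {κ : n ⟶ k}
    (h : SLDRefutation P G κ) (ρ : k ⟶ m) :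
    ∃ d, ∀ A ∈ G, Derivable P d (A.subst (κ ≫ ρ)) := by
  induction h with
  | nil n => exact ⟨0, fun A hA => by cases hA⟩
  | step hs _ ih =>
    obtain ⟨d, hd⟩ := ih ρ
    refine ⟨d + 1, fun A hA => ?_⟩
    rw [Category.assoc]
    exact hs.derivable hd A hA

/-- Refutability by leftmost resolution with instances of clauses: the goal itself is never
instantiated, so the context stays fixed. -/
inductive InstRefutation (P : Program L) {m : Ctx L} : Goal m → Prop
  | nil : InstRefutation P []
  | step (C : Clause L) (hC : C ∈ P) (τ : C.ctx ⟶ m) (l : Goal m)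
      (h : InstRefutation P (Goal.subst C.body τ ++ l)) : InstRefutation P (C.head.subst τ :: l)

theorem InstRefutation.append {P : Program L} {m : Ctx L} {l₁ l₂ : Goal m}
    (h₁ : InstRefutation P l₁) (h₂ : InstRefutation P l₂) : InstRefutation P (l₁ ++ l₂) := by
  induction h₁ with
  | nil => exact h₂
  | step C hC τ l _ ih => exact .step C hC τ (l ++ l₂) (List.append_assoc _ l l₂ ▸ ih)

theorem instRefutation_of_derivable {P : Program L} {m : Ctx L} (d : ℕ) (l : Goal m)
    (h : ∀ A ∈ l, Derivable P d A) : InstRefutation P l := by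
  induction d generalizing l with
  | zero =>
    rw [List.eq_nil_iff_forall_not_mem.2 h]
    exact .nil
  | succ d ihd =>
    induction l with
    | nil => exact .nil
    | cons A l ih =>
      obtain ⟨C, hC, τ, rfl, hB⟩ := h A List.mem_cons_self
      refine .step C hC τ l (.append (ihd _ ?_) (ih fun B hB => h B (List.mem_cons_of_mem _ hB)))
      simpa [Goal.subst] using hB

/-- The lifting lemma: a refutation of the instance `Gθ` by instances of clauses lifts to an
SLD-refutation of `G`, every step being replaced by one with a most general unifier. -/
theorem InstRefutation.lift {P : Program L} {m : Ctx L} {l : Goal m} (h : InstRefutation P l)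
    {n : Ctx L} (G : Goal n) (θ : n ⟶ m) (hG : Goal.subst G θ = l) :
    HasSLDRefutationWithCorrectAnswer P G θ := by
  induction h generalizing n with
  | nil =>
    obtain rfl := List.map_eq_nil_iff.1 hG
    exact ⟨n, 𝟙 n, θ, .nil n, Category.id_comp θ⟩
  | step C hC τ l _ ih =>
    obtain ⟨A, G, rfl, hA, hl⟩ := List.map_eq_cons_iff.1 hG
    obtain ⟨k, σ, σ', u, hmgu, rfl, rfl⟩ := IsUnifier.exists_isMGU hA
    obtain ⟨k', κ, ρ, hκ, rfl⟩ := ih (Goal.subst C.body σ' ++ Goal.subst G σ) u (by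
      rw [← hl, ← Goal.subst_subst]
      change _ = _ ++ Goal.subst G (σ ≫ u)
      rw [← Goal.subst_subst]
      simp only [Goal.subst, List.map_append])
    exact ⟨k', σ ≫ κ, ρ, .step (.mk [] A G C hC σ σ' hmgu) hκ, Category.assoc σ κ ρ⟩

theorem hasSLDRefutationWithCorrectAnswer_iff {P : Program L} {n m : Ctx L} {G : Goal n}
    {θ : n ⟶ m} : HasSLDRefutationWithCorrectAnswer P G θ ↔
      ∃ d, ∀ A ∈ G, Derivable P d (A.subst θ) := by
  constructor
  · rintro ⟨k, κ, ρ, h, rfl⟩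
    exact h.derivable ρ
  · rintro ⟨d, hd⟩
    refine (instRefutation_of_derivable d (Goal.subst G θ) ?_).lift G θ rfl
    simpa [Goal.subst] using hd

end LP

theorem mainTheorem2 {L : FirstOrder.Language} (P : LP.Program L) {n m : LP.Ctx L}
    (G : LP.Goal n) (θ : n ⟶ m) :
    (LP.saturatedOrTree P G).HasRefutationSubtree θ ↔
      LP.HasSLDRefutationWithCorrectAnswer P G θ :=
  LP.hasRefutationSubtree_iff.trans LP.hasSLDRefutationWithCorrectAnswer_iff.symm
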